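/- For a finite poset $P$, let $|P|$ be the geometric realization of its order complex, the simplicial complex whose simplices are the nonempty chains of $P$; two finite posets are called homotopy equivalent if their realizations are, and $P$ is called contractible if $|P|$ is contractible. Let $X$ be a finite meet-semilattice, let $g$ be an automorphism of $X$, and let $x\in X$ (not necessarily fixed by $g$). Let $X^g=\{z\in X : g(z)=z\}$ be the fixed-point subposet, let ${}^gX=\{y\in X : y\le z \text{ for some } z\in X^g\}$ be its downward closure in $X$, and put $X^g_{>x}=\{z\in X^g : z>x\}$ and ${}^gX_{>x}=\{y\in {}^gX : y>x\}$. Then the posets $X^g_{>x}$ and ${}^gX_{>x}$ are homotopy equivalent; more precisely, the inclusion $i: X^g_{>x}\hookrightarrow {}^gX_{>x}$ induces a homotopy equivalence $|X^g_{>x}|\to|{}^gX_{>x}|$. (If $X^g_{>x}$ is empty, then so is ${}^gX_{>x}$.) Moreover, for every $y\in{}^gX_{>x}$ the fibre $y\backslash i=\{z\in X^g_{>x} : z\ge y\}$ is nonempty and closed under binary meets in $X$, has a least element, and is contractible. -/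

import Mathlib

/-- The order complex of a poset `P`: its faces are the nonempty finite chains of `P`. -/
def orderComplex (P : Type*) [PartialOrder P] : AbstractSimplicialComplex P where
  faces := {s | s.Nonempty ∧ IsChain (· ≤ ·) (s : Set P)}
  isRelLowerSet_faces := fun _ hs =>
    ⟨hs.1, fun _ hts ht => ⟨ht, hs.2.mono (Finset.coe_subset.mpr hts)⟩⟩
  singleton_mem := fun v => ⟨Finset.singleton_nonempty v, by simp⟩

/-- The geometric realization of an abstract simplicial complex on a finite vertex set `V`, in
barycentric coordinates: nonnegative weights on the vertices, of total weight one, whose support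
is a face. -/
def AbstractSimplicialComplex.realization {V : Type*} [Finite V]
    (K : AbstractSimplicialComplex V) : Set (V → ℝ) :=
  {w | (∀ v, 0 ≤ w v) ∧ ∑ᶠ v, w v = 1 ∧ ∃ s ∈ K.faces, (s : Set V) = Function.support w}

/-- The topological space attached to a finite poset: the geometric realization of its order
complex, with the topology of a subspace of `P → ℝ`. -/
abbrev PosetSpace (P : Type*) [PartialOrder P] [Finite P] : Type _ :=
  ↥(orderComplex P).realization

theorem linearMap_mem_realization {P Q : Type*} [PartialOrder P] [Finite P] [PartialOrder Q]
    [Finite Q] (f : P →o Q) {w : P → ℝ} (hw : w ∈ (orderComplex P).realization) :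
    FunOnFinite.linearMap ℝ ℝ f w ∈ (orderComplex Q).realization := by
  classical
  have := Fintype.ofFinite P
  have := Fintype.ofFinite Q
  obtain ⟨h0, h1, s, hs, hsw⟩ := hw
  refine ⟨fun q => ?_, ?_, s.image f, ⟨hs.1.image f, ?_⟩, ?_⟩
  · rw [FunOnFinite.linearMap_apply_apply]
    exact Finset.sum_nonneg fun p _ => h0 p
  · rw [finsum_eq_sum_of_fintype] at h1 ⊢
    simp only [FunOnFinite.linearMap_apply_apply, ← h1]
    exact Finset.sum_fiberwise Finset.univ f w
  · rw [Finset.coe_image]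
    rintro _ ⟨a, ha, rfl⟩ _ ⟨b, hb, rfl⟩ _
    exact (hs.2.total ha hb).imp (fun h => f.monotone h) fun h => f.monotone h
  · ext q
    rw [Finset.coe_image, hsw, Function.mem_support, FunOnFinite.linearMap_apply_apply, ne_eq,
      Finset.sum_eq_zero_iff_of_nonneg fun p _ => h0 p]
    simp [and_comm]

/-- The continuous map of realizations induced by an order-preserving map `f`: it is affine on each
simplex and sends the vertex `p` to the vertex `f p`, so that the weight of `q` in the image is the
sum of the weights of the `p` with `f p = q`. -/
noncomputable def PosetSpace.map {P Q : Type*} [PartialOrder P] [Finite P] [PartialOrder Q]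
    [Finite Q] (f : P →o Q) : C(PosetSpace P, PosetSpace Q) where
  toFun w := ⟨FunOnFinite.linearMap ℝ ℝ f w.1, linearMap_mem_realization f w.2⟩
  continuous_toFun :=
    ((FunOnFinite.continuous_linearMap ℝ ℝ f).comp continuous_subtype_val).subtype_mk _

section
variable {X : Type*} [SemilatticeInf X]

/-- The set of fixed points of `g` that are strictly above `x`. -/
def fixedAbove (g : X ≃o X) (x : X) : Set X :=
  {z | g z = z ∧ x < z}

/-- The set of elements strictly above `x` in the downward closure of the fixed points of `g`. -/
def lowerFixedAbove (g : X ≃o X) (x : X) : Set X :=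
  {y | y ∈ lowerClosure {z | g z = z} ∧ x < y}

theorem fixedAbove_subset_lowerFixedAbove (g : X ≃o X) (x : X) :
    fixedAbove g x ⊆ lowerFixedAbove g x :=
  fun _ hz => ⟨subset_lowerClosure hz.1, hz.2⟩

/-- The inclusion of the fixed points above `x` into the elements above `x` of the downward
closure of the fixed points, as an order-preserving map. -/
def fixedAboveIncl (g : X ≃o X) (x : X) : fixedAbove g x →o lowerFixedAbove g x where
  toFun := Set.inclusion (fixedAbove_subset_lowerFixedAbove g x)
  monotone' := fun _ _ h => h

/-- The fibre over `y` of the inclusion: the fixed points strictly above `x` that are at least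
`y`. -/
def fixedAboveFibre (g : X ≃o X) (x y : X) : Set X :=
  {z | z ∈ fixedAbove g x ∧ y ≤ z}

end

/-!
Since the chosen set `F` of elements (the fixed points of `g`) is closed under meets, so is every
fibre of the inclusion, and a nonempty finite meet-closed set has a least element. Sending `y` to
the least element of its fibre is a left adjoint of the inclusion, and a Galois connection between
finite posets induces a homotopy equivalence because pointwise comparable monotone maps are
homotopic. The last fact needs a homotopy only for the two inclusions of `P` as the bottom and top
of `P × Bool`: at time `t`, lift the highest portion of mass `t` of a chain from the bottom copy to
the top one.
-/

theorem mem_realization_orderComplex_iff {P : Type*} [PartialOrder P] [Finite P] {w : P → ℝ} :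
    w ∈ (orderComplex P).realization ↔
      (∀ p, 0 ≤ w p) ∧ ∑ᶠ p, w p = 1 ∧ IsChain (· ≤ ·) (Function.support w) := by
  constructor
  · rintro ⟨hnonneg, hsum, s, hs, hsw⟩
    exact ⟨hnonneg, hsum, hsw ▸ hs.2⟩
  · rintro ⟨hnonneg, hsum, hchain⟩
    refine ⟨hnonneg, hsum, (Set.toFinite (Function.support w)).toFinset, ⟨?_, ?_⟩, ?_⟩
    · rw [Set.Finite.toFinset_nonempty, Function.support_nonempty_iff]
      rintro rfl
      simp at hsum
    · simpa only [Set.Finite.coe_toFinset] using hchain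
    · exact Set.Finite.coe_toFinset _

section RaisedWeight

variable {P : Type*} [Preorder P]

/-- The part of the weight `w p` that belongs to the highest portion of mass `t` of `w`, when the
support of `w` is a chain whose weight is used up from the top downwards. -/
noncomputable def raisedWeight (t : ℝ) (w : P → ℝ) (p : P) : ℝ :=
  min (w p) (max 0 (t - ∑ᶠ q ∈ Set.Ioi p, w q))

theorem raisedWeight_le (t : ℝ) (w : P → ℝ) (p : P) : raisedWeight t w p ≤ w p :=
  min_le_left _ _

theorem raisedWeight_nonneg {w : P → ℝ} (hw : ∀ p, 0 ≤ w p) (t : ℝ) (p : P) :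
    0 ≤ raisedWeight t w p :=
  le_min (hw p) (le_max_left _ _)

theorem raisedWeight_of_nonpos {w : P → ℝ} (hw : ∀ p, 0 ≤ w p) {t : ℝ} (ht : t ≤ 0) (p : P) :
    raisedWeight t w p = 0 := by
  have hsum : 0 ≤ ∑ᶠ q ∈ Set.Ioi p, w q := finsum_nonneg fun q => finsum_nonneg fun _ => hw q
  rw [raisedWeight, max_eq_left (by linarith), min_eq_right (hw p)]

theorem finsum_Ioi_lt_of_raisedWeight_pos {t : ℝ} {w : P → ℝ} {p : P}
    (h : 0 < raisedWeight t w p) : ∑ᶠ q ∈ Set.Ioi p, w q < t := by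
  simpa only [lt_max_iff, lt_irrefl, false_or, sub_pos] using (lt_min_iff.mp h).2

theorem lt_add_finsum_Ioi_of_raisedWeight_lt {t : ℝ} {w : P → ℝ} {p : P}
    (h : raisedWeight t w p < w p) : t < w p + ∑ᶠ q ∈ Set.Ioi p, w q := by
  have hlt : max 0 (t - ∑ᶠ q ∈ Set.Ioi p, w q) < w p :=
    (min_lt_iff.mp h).resolve_left (lt_irrefl _)
  exact sub_lt_iff_lt_add.mp ((le_max_right _ _).trans_lt hlt)

end RaisedWeight

theorem add_finsum_Ioi_le_finsum {P M : Type*} [PartialOrder P] [Finite P] [AddCommMonoid M]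
    [PartialOrder M] [IsOrderedAddMonoid M] {w : P → M} (hw : ∀ p, 0 ≤ w p) {p : P} {s : Set P}
    (hs : Set.Ici p ⊆ s) :
    w p + ∑ᶠ q ∈ Set.Ioi p, w q ≤ ∑ᶠ q ∈ s, w q := by
  rw [← finsum_mem_insert w Set.self_notMem_Ioi (Set.toFinite _), Set.Ioi_insert,
    finsum_mem_def, finsum_mem_def]
  exact finsum_le_finsum' (Set.toFinite _) (Set.toFinite _)
    (Set.indicator_le_indicator_of_subset hs hw)

theorem raisedWeight_of_finsum_le {P : Type*} [PartialOrder P] [Finite P] {w : P → ℝ}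
    (hw : ∀ p, 0 ≤ w p) {t : ℝ} (ht : ∑ᶠ p, w p ≤ t) (p : P) : raisedWeight t w p = w p := by
  have hle : w p + ∑ᶠ q ∈ Set.Ioi p, w q ≤ t :=
    (add_finsum_Ioi_le_finsum hw (Set.subset_univ _)).trans (by rwa [finsum_mem_univ])
  exact min_eq_left ((le_sub_iff_add_le.mpr hle).trans (le_max_right _ _))

theorem continuous_raisedWeight {P : Type*} [Preorder P] [Finite P] (p : P) :
    Continuous fun tw : ℝ × (P → ℝ) => raisedWeight tw.1 tw.2 p := by
  have hsum : Continuous fun tw : ℝ × (P → ℝ) => ∑ᶠ q ∈ Set.Ioi p, tw.2 q :=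
    continuous_finsum_cond (fun q _ => by fun_prop) (locallyFinite_of_finite _)
  unfold raisedWeight
  fun_prop

/-- The weights on `P × Bool` obtained from `w` by placing the highest portion of mass `t` in the
copy `P × {true}` and the rest in `P × {false}`. -/
noncomputable def prismWeight {P : Type*} [Preorder P] (t : ℝ) (w : P → ℝ) : P × Bool → ℝ
  | (p, true) => raisedWeight t w p
  | (p, false) => w p - raisedWeight t w p

theorem prismWeight_nonneg {P : Type*} [Preorder P] {w : P → ℝ} (hw : ∀ p, 0 ≤ w p) (t : ℝ) :
    ∀ x, 0 ≤ prismWeight t w x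
  | (p, true) => raisedWeight_nonneg hw t p
  | (p, false) => sub_nonneg.mpr (raisedWeight_le t w p)

theorem finsum_prismWeight {P : Type*} [Preorder P] [Finite P] (t : ℝ) (w : P → ℝ) :
    ∑ᶠ x, prismWeight t w x = ∑ᶠ p, w p := by
  have := Fintype.ofFinite P
  simp only [finsum_eq_sum_of_fintype, Fintype.sum_prod_type, Fintype.sum_bool, prismWeight,
    add_sub_cancel]

theorem isChain_support_prismWeight {P : Type*} [PartialOrder P] [Finite P] {w : P → ℝ}
    (hw : ∀ p, 0 ≤ w p) (hchain : IsChain (· ≤ ·) (Function.support w)) (t : ℝ) :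
    IsChain (· ≤ ·) (Function.support (prismWeight t w)) := by
  have fst_mem_support : ∀ x ∈ Function.support (prismWeight t w), x.1 ∈ Function.support w := by
    rintro ⟨p, b⟩ hx (hp : w p = 0)
    have hraised : raisedWeight t w p = 0 :=
      le_antisymm (hp ▸ raisedWeight_le t w p) (raisedWeight_nonneg hw t p)
    cases b <;> simp [prismWeight, hp, hraised] at hx
  have le_of_raised {p q : P} (hp : (p, false) ∈ Function.support (prismWeight t w))
      (hq : (q, true) ∈ Function.support (prismWeight t w)) : p ≤ q := by
    by_contra hpq
    have hqp : q < p :=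
      ((hchain.total (fst_mem_support _ hp) (fst_mem_support _ hq)).resolve_left hpq).lt_of_not_ge
        hpq
    have hbelow : t < w p + ∑ᶠ r ∈ Set.Ioi p, w r := lt_add_finsum_Ioi_of_raisedWeight_lt <|
      (raisedWeight_le t w p).lt_of_ne fun h => hp (sub_eq_zero.mpr h.symm)
    have habove : ∑ᶠ r ∈ Set.Ioi q, w r < t :=
      finsum_Ioi_lt_of_raisedWeight_pos ((raisedWeight_nonneg hw t q).lt_of_ne' hq)
    exact (hbelow.trans_le (add_finsum_Ioi_le_finsum hw (Set.Ici_subset_Ioi.mpr hqp))).not_gt habove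
  rintro ⟨p, b⟩ hp ⟨q, c⟩ hq -
  have htotal : p ≤ q ∨ q ≤ p := hchain.total (fst_mem_support _ hp) (fst_mem_support _ hq)
  cases b <;> cases c
  · exact htotal.imp (⟨·, le_rfl⟩) (⟨·, le_rfl⟩)
  · exact .inl ⟨le_of_raised hp hq, Bool.false_le _⟩
  · exact .inr ⟨le_of_raised hq hp, Bool.false_le _⟩
  · exact htotal.imp (⟨·, le_rfl⟩) (⟨·, le_rfl⟩)

theorem prismWeight_mem_realization {P : Type*} [PartialOrder P] [Finite P] {w : P → ℝ}
    (hw : w ∈ (orderComplex P).realization) (t : ℝ) :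
    prismWeight t w ∈ (orderComplex (P × Bool)).realization := by
  obtain ⟨hnonneg, hsum, hchain⟩ := mem_realization_orderComplex_iff.mp hw
  exact mem_realization_orderComplex_iff.mpr ⟨prismWeight_nonneg hnonneg t,
    (finsum_prismWeight t w).trans hsum, isChain_support_prismWeight hnonneg hchain t⟩

theorem continuous_prismWeight {P : Type*} [Preorder P] [Finite P] :
    Continuous fun tw : ℝ × (P → ℝ) => prismWeight tw.1 tw.2 := by
  refine continuous_pi fun ⟨p, b⟩ => ?_
  have hraised := continuous_raisedWeight p
  cases b <;> simp only [prismWeight] <;> fun_prop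

namespace PosetSpace

variable {P Q R : Type*} [PartialOrder P] [Finite P] [PartialOrder Q] [Finite Q]
  [PartialOrder R] [Finite R]

theorem map_id : map (OrderHom.id : P →o P) = ContinuousMap.id _ := by
  ext1 w
  exact Subtype.ext (LinearMap.congr_fun (FunOnFinite.linearMap_id ℝ ℝ P) w.1)

theorem map_comp (f : Q →o R) (h : P →o Q) : map (f.comp h) = (map f).comp (map h) := by
  ext1 w
  exact Subtype.ext (LinearMap.congr_fun (FunOnFinite.linearMap_comp ℝ ℝ h f) w.1)

theorem map_prod_const_apply [DecidableEq Q] (b : Q) (w : PosetSpace P) (p : P) (c : Q) :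
    (map (OrderHom.id.prod (OrderHom.const P b)) w).1 (p, c) = if b = c then w.1 p else 0 := by
  classical
  have := Fintype.ofFinite P
  refine (FunOnFinite.linearMap_apply_apply ℝ ℝ _ w.1 (p, c)).trans ?_
  by_cases h : b = c <;> simp [h, Finset.sum_filter]

theorem homotopic_map_prod_false_true :
    (map ((OrderHom.id : P →o P).prod (OrderHom.const P false))).Homotopic
      (map (OrderHom.id.prod (OrderHom.const P true))) := by
  refine ⟨⟨⟨fun tw => ⟨prismWeight tw.1 tw.2.1, prismWeight_mem_realization tw.2.2 _⟩, ?_⟩,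
    fun w => Subtype.ext ?_, fun w => Subtype.ext ?_⟩⟩
  · exact (continuous_prismWeight.comp (by fun_prop :
      Continuous fun tw : unitInterval × PosetSpace P => ((tw.1 : ℝ), tw.2.1))).subtype_mk _
  · ext ⟨p, b⟩
    have hzero := raisedWeight_of_nonpos w.2.1 le_rfl p
    rw [map_prod_const_apply]
    cases b <;> simp [prismWeight, hzero]
  · ext ⟨p, b⟩
    have hfull := raisedWeight_of_finsum_le w.2.1 w.2.2.1.le p
    rw [map_prod_const_apply]
    cases b <;> simp [prismWeight, hfull]

theorem homotopic_map_of_le {f h : P →o Q} (hfh : f ≤ h) : (map f).Homotopic (map h) := by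
  let prism : P × Bool →o Q :=
    { toFun := fun x => cond x.2 (h x.1) (f x.1)
      monotone' := by
        rintro ⟨p, b⟩ ⟨q, c⟩ ⟨hpq, hbc⟩
        cases b <;> cases c
        · exact f.monotone hpq
        · exact (f.monotone hpq).trans (hfh q)
        · exact absurd (hbc rfl) Bool.false_ne_true
        · exact h.monotone hpq }
  have hbot : prism.comp (OrderHom.id.prod (OrderHom.const P false)) = f := rfl
  have htop : prism.comp (OrderHom.id.prod (OrderHom.const P true)) = h := rfl
  rw [← hbot, ← htop, map_comp, map_comp]
  exact (ContinuousMap.Homotopic.refl (map prism)).comp homotopic_map_prod_false_true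

/-- The homotopy equivalence of realizations whose two directions are induced by the adjoints of a
Galois connection between finite posets. -/
noncomputable def homotopyEquivOfGaloisConnection (l : P →o Q) (u : Q →o P)
    (gc : GaloisConnection l u) :
    ContinuousMap.HomotopyEquiv (PosetSpace P) (PosetSpace Q) where
  toFun := map l
  invFun := map u
  left_inv := by
    rw [← map_comp, ← map_id]
    exact (homotopic_map_of_le gc.le_u_l).symm
  right_inv := by
    rw [← map_comp, ← map_id]
    exact homotopic_map_of_le gc.l_u_le

/-- The case of Quillen's fibre lemma in which every fibre has a least element. -/
theorem exists_homotopyEquiv_of_isLeast_fibre (i : P →o Q)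
    (h : ∀ q, ∃ p, IsLeast {p | q ≤ i p} p) :
    ∃ e : ContinuousMap.HomotopyEquiv (PosetSpace P) (PosetSpace Q), e.toFun = map i := by
  choose r hr using h
  have gc : GaloisConnection r i := fun q p =>
    ⟨fun hrp => (hr q).1.trans (i.monotone hrp), fun hqp => (hr q).2 hqp⟩
  exact ⟨(homotopyEquivOfGaloisConnection ⟨r, gc.monotone_l⟩ i gc).symm, rfl⟩

noncomputable instance [Unique P] : Unique (PosetSpace P) where
  default := ⟨1, mem_realization_orderComplex_iff.mpr
    ⟨fun _ => zero_le_one, finsum_unique _, Set.subsingleton_of_subsingleton.isChain⟩⟩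
  uniq w := Subtype.ext <| funext fun p => by
    rw [Unique.eq_default p]
    exact (finsum_unique w.1).symm.trans w.2.2.1

theorem contractibleSpace_of_isBot {p : P} (hp : IsBot p) : ContractibleSpace (PosetSpace P) := by
  obtain ⟨e, -⟩ := exists_homotopyEquiv_of_isLeast_fibre (OrderHom.const P Unit.unit)
    fun _ => ⟨p, trivial, fun q _ => hp q⟩
  exact e.contractibleSpace

end PosetSpace

theorem exists_isLeast_of_infClosed {X : Type*} [SemilatticeInf X] {s : Set X} (hs : InfClosed s)
    (hfin : s.Finite) (hne : s.Nonempty) : ∃ m, IsLeast s m :=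
  (hfin.exists_minimal hne).imp fun _ => hs.codirectedOn.minimal_iff_isLeast.mp

theorem infClosed_fixedPoints {X F : Type*} [SemilatticeInf X] [FunLike F X X] [InfHomClass F X X]
    (f : F) : InfClosed (Function.fixedPoints f) :=
  fun a ha b hb => (map_inf f a b).trans (congrArg₂ (· ⊓ ·) ha hb)

theorem mainTheorem12_general {X : Type*} [SemilatticeInf X] {F U : Set X} (hF : InfClosed F)
    (hU : IsUpperSet U) [Finite ↥(F ∩ U)] [Finite ↥((lowerClosure F : Set X) ∩ U)] :
    (∃ e : ContinuousMap.HomotopyEquiv (PosetSpace ↥(F ∩ U))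
        (PosetSpace ↥((lowerClosure F : Set X) ∩ U)),
      e.toFun = PosetSpace.map
        ⟨Set.inclusion (Set.inter_subset_inter_left U subset_lowerClosure), fun _ _ h => h⟩) ∧
    ∀ y ∈ (lowerClosure F : Set X) ∩ U,
      (F ∩ U ∩ Set.Ici y).Nonempty ∧
      InfClosed (F ∩ U ∩ Set.Ici y) ∧
      (∃ m, IsLeast (F ∩ U ∩ Set.Ici y) m) ∧
      ContractibleSpace (PosetSpace ↥(F ∩ U ∩ Set.Ici y)) := by
  have nonempty {y : X} (hy : y ∈ (lowerClosure F : Set X) ∩ U) : (F ∩ U ∩ Set.Ici y).Nonempty :=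
    let ⟨z, hz, hyz⟩ := hy.1
    ⟨z, ⟨hz, hU hyz hy.2⟩, hyz⟩
  have infClosed {y : X} (hy : y ∈ U) : InfClosed (F ∩ U ∩ Set.Ici y) :=
    fun _ ha _ hb => ⟨⟨hF ha.1.1 hb.1.1, hU (le_inf ha.2 hb.2) hy⟩, le_inf ha.2 hb.2⟩
  have exists_isLeast {y : X} (hy : y ∈ (lowerClosure F : Set X) ∩ U) :
      ∃ m, IsLeast (F ∩ U ∩ Set.Ici y) m :=
    exists_isLeast_of_infClosed (infClosed hy.2) (Set.toFinite _) (nonempty hy)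
  refine ⟨PosetSpace.exists_homotopyEquiv_of_isLeast_fibre _ fun y => ?_, fun y hy => ?_⟩
  · obtain ⟨m, hm⟩ := exists_isLeast y.2
    exact ⟨⟨m, hm.1.1⟩, hm.1.2, fun z hz => hm.2 ⟨z.2, hz⟩⟩
  · obtain ⟨m, hm⟩ := exists_isLeast hy
    exact ⟨nonempty hy, infClosed hy.2, ⟨m, hm⟩,
      PosetSpace.contractibleSpace_of_isBot (p := ⟨m, hm.1⟩) fun z => hm.2 z.2⟩

theorem mainTheorem12 {X : Type*} [SemilatticeInf X] [Finite X] (g : X ≃o X) (x : X) :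
    (∃ e : ContinuousMap.HomotopyEquiv (PosetSpace (fixedAbove g x))
        (PosetSpace (lowerFixedAbove g x)),
      e.toFun = PosetSpace.map (fixedAboveIncl g x)) ∧
    ∀ y ∈ lowerFixedAbove g x,
      (fixedAboveFibre g x y).Nonempty ∧
      InfClosed (fixedAboveFibre g x y) ∧
      (∃ m, IsLeast (fixedAboveFibre g x y) m) ∧
      ContractibleSpace (PosetSpace (fixedAboveFibre g x y)) :=
  mainTheorem12_general (infClosed_fixedPoints g) (isUpperSet_Ioi x)
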